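/- **Setting.** A Kreĭn space is a complex space $\mathcal H$ with an indefinite inner product $[\cdot,\cdot]$ (linear in the first variable) such that $[\xi,\eta]=\langle J\xi,\eta\rangle$ for some Hilbert space inner product $\langle\cdot,\cdot\rangle$ on $\mathcal H$ and some bounded operator $J$ with $J^*=J^{-1}=J$. $\mathcal L(\mathcal H,\mathcal K)$ denotes the bounded linear operators and $T^\sharp$ the adjoint with respect to the indefinite inner products. Let $X$ be a set and $\mathcal H$ a Kreĭn space. A hermitian kernel is a map $K:X\times X\to\mathcal L(\mathcal H)$ with $K(x,y)=K(y,x)^\sharp$. For finitely supported $f,g:X\to\mathcal H$ put $[f,g]_K=\sum_{x,y\in X}[K(x,y)f(y),g(x)]$. A hermitian kernel $L$ is positive definite if $[f,f]_L\ge 0$ for all $f$; for hermitian kernels, $A\le B$ means $[f,f]_A\le[f,f]_B$ for all $f$. Positive definite kernels $A,B$ are disjoint if the only positive definite kernel $P$ with $P\le A$ and $P\le B$ is $P=0$. A Kolmogorov decomposition of $K$ is a pair $(V;\mathcal K)$ of a Kreĭn space $\mathcal K$ and a family $V(x)\in\mathcal L(\mathcal H,\mathcal K)$, $x\in X$, such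 that $K(x,y)=V(x)^\sharp V(y)$ for all $x,y$, and the linear span of $\bigcup_{x}V(x)\mathcal H$ is dense in $\mathcal K$. Let $S$ be a group with an action $\phi:S\times X\to X$, and let $\alpha:S\times X\to\mathbb C\setminus\{0\}$ satisfy $$\alpha(ab,x)\overline{\alpha(ab,y)}=\alpha(a,\phi(b,x))\overline{\alpha(a,\phi(b,y))}\,\alpha(b,x)\overline{\alpha(b,y)},\qquad \alpha(aa^{-1},x)=1$$ for all $a,b\in S$, $x,y\in X$. Then $\sigma(a,b)=\alpha(a,\phi(b,x))^{-1}\alpha(b,x)^{-1}\alpha(ab,x)$ does not depend on $x\in X$ (if $X=\emptyset$, put $\sigma=1$). A hermitian kernel $K$ is $\phi$-invariant if $$K(x,\phi(a,y))=\overline{\alpha(a,\phi(a^{-1},x))}\,\alpha(a,y)\,K(\phi(a^{-1},x),y)\qquad(x,y\in X,\ a\in S).$$ A symmetric projective representation of $S$ on a Kreĭn space $\mathcal K$ is a map $U:S\to\mathcal L(\mathcal K)$ with $U(a)U(b)=\sigma(a,b)U(ab)$ and $U(a)^\sharp=\overline{\sigma(a^{-1},a)}\,U(a^{-1})$ for all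 $a,b\in S$; on a Hilbert space, $\sharp$ is the Hilbert space adjoint. $U$ on $\mathcal K$ and $T$ on $\mathcal G$ are similar if $T(a)\Phi=\Phi U(a)$ for all $a\in S$ and some bounded, boundedly invertible linear $\Phi:\mathcal K\to\mathcal G$. **Theorem.** Let $K:X\times X\to\mathcal L(\mathcal H)$ be a $\phi$-invariant hermitian kernel. The following are equivalent: 1. There exists a $\phi$-invariant positive definite kernel $L:X\times X\to\mathcal L(\mathcal H)$ such that $-L\le K\le L$. 2. $K$ has a Kolmogorov decomposition $(V;\mathcal K)$ for which there is a symmetric projective representation $U$ of $S$ on $\mathcal K$ with $V(\phi(a,x))=\alpha(a,x)U(a)V(x)$ for all $a\in S$, $x\in X$, such that $U$ is similar to a symmetric projective representation of $S$ on a Hilbert space. 3. $K=K_+-K_-$ for two disjoint $\phi$-invariant positive definite kernels $K_+,K_-:X\times X\to\mathcal L(\mathcal H)$. -/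

import Mathlib

open scoped ComplexConjugate

universe u v w

section Krein

/-- A Krein space, presented by a Hilbert space together with a fundamental symmetry `J`
(`J* = J⁻¹ = J`). The indefinite inner product is `[x, y] = ⟨J x, y⟩`, see `KreinSpace.form`. The
ambient norm is a unitary norm; the notions below depend on `J` only through the form. -/
class KreinSpace (H : Type*) [NormedAddCommGroup H] [InnerProductSpace ℂ H]
    [CompleteSpace H] where
  /-- The fundamental symmetry. -/
  J : H →L[ℂ] H
  adjoint_J : ContinuousLinearMap.adjoint J = J
  J_comp_J : J ∘L J = ContinuousLinearMap.id ℂ H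

namespace KreinSpace

variable {H : Type*} [NormedAddCommGroup H] [InnerProductSpace ℂ H] [CompleteSpace H]
  [KreinSpace H]
variable {G : Type*} [NormedAddCommGroup G] [InnerProductSpace ℂ G] [CompleteSpace G]
  [KreinSpace G]

/-- The indefinite inner product `[x, y] = ⟨J x, y⟩`, linear in `x` and conjugate linear in `y`
(Mathlib's `inner` is conjugate linear in its first argument). -/
noncomputable def form (x y : H) : ℂ := inner ℂ y (J x)

/-- The adjoint `T♯` of a bounded operator with respect to the indefinite inner products. -/
noncomputable def sharp (T : H →L[ℂ] G) : G →L[ℂ] H :=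
  J ∘L ContinuousLinearMap.adjoint T ∘L J

theorem J_J (x : H) : J (J x) = x := by
  have h := congrArg (fun T : H →L[ℂ] H => T x) (J_comp_J (H := H))
  simpa using h

theorem inner_J_left (x y : H) : inner ℂ (J x) y = inner ℂ x (J y) := by
  conv_lhs => rw [← adjoint_J (H := H)]
  exact ContinuousLinearMap.adjoint_inner_left J y x

theorem form_conj (x y : H) : conj (form x y) = form y x := by
  unfold form
  rw [inner_conj_symm, inner_J_left]

theorem form_sharp_right (T : H →L[ℂ] G) (x : H) (y : G) :
    form (T x) y = form x (sharp T y) := by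
  simp only [form, sharp, ContinuousLinearMap.comp_apply, inner_J_left, J_J]
  rw [ContinuousLinearMap.adjoint_inner_left, inner_J_left]

/-- The adjoint is determined by the indefinite inner products alone. -/
theorem eq_sharp (T : H →L[ℂ] G) (R : G →L[ℂ] H)
    (h : ∀ x y, form (T x) y = form x (R y)) : R = sharp T := by
  ext y
  refine ext_inner_right ℂ fun z => ?_
  have := (h (J z) y).symm.trans (form_sharp_right T (J z) y)
  simpa only [form, J_J] using this

end KreinSpace

end Krein

section Kernels

variable {X : Type*} {H : Type*} [NormedAddCommGroup H] [InnerProductSpace ℂ H]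
  [CompleteSpace H] [KreinSpace H]

/-- A hermitian kernel: `K(x, y) = K(y, x)♯`. -/
def IsHermitianKernel (K : X → X → H →L[ℂ] H) : Prop :=
  ∀ x y, K x y = KreinSpace.sharp (K y x)

/-- The inner product `[f, g]_K = ∑_{x, y} [K(x, y) f(y), g(x)]` on finitely supported
functions. -/
noncomputable def kernelForm (K : X → X → H →L[ℂ] H) (f g : X →₀ H) : ℂ :=
  ∑ x ∈ g.support, ∑ y ∈ f.support, KreinSpace.form (K x y (f y)) (g x)

/-- For a hermitian kernel `[·, ·]_K` is hermitian; in particular `[f, f]_K` is real, so that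
the order relations below may be read off from real parts. -/
theorem IsHermitianKernel.conj_kernelForm {K : X → X → H →L[ℂ] H} (hK : IsHermitianKernel K)
    (f g : X →₀ H) : conj (kernelForm K f g) = kernelForm K g f := by
  unfold kernelForm
  simp only [map_sum]
  rw [Finset.sum_comm]
  refine Finset.sum_congr rfl fun y _ => Finset.sum_congr rfl fun x _ => ?_
  rw [hK x y, KreinSpace.form_conj, KreinSpace.form_sharp_right]

/-- A positive definite kernel: a hermitian kernel with `[f, f]_L ≥ 0` for all `f`. -/
def IsPosDefKernel (L : X → X → H →L[ℂ] H) : Prop :=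
  IsHermitianKernel L ∧ ∀ f : X →₀ H, 0 ≤ (kernelForm L f f).re

/-- The order `A ≤ B` on hermitian kernels: `[f, f]_A ≤ [f, f]_B` for all `f`. -/
def KernelLE (A B : X → X → H →L[ℂ] H) : Prop :=
  ∀ f : X →₀ H, (kernelForm A f f).re ≤ (kernelForm B f f).re

/-- Disjointness of two positive definite kernels. -/
def DisjointKernels (A B : X → X → H →L[ℂ] H) : Prop :=
  ∀ P : X → X → H →L[ℂ] H, IsPosDefKernel P → KernelLE P A → KernelLE P B → P = 0

/-- `(V; 𝒦)` is a Kolmogorov decomposition of `K`: `K(x, y) = V(x)♯ V(y)`, and the linear span of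
the ranges of the `V(x)` is dense in `𝒦`. -/
def IsKolmogorovDecomposition {𝒦 : Type*} [NormedAddCommGroup 𝒦] [InnerProductSpace ℂ 𝒦]
    [CompleteSpace 𝒦] [KreinSpace 𝒦] (K : X → X → H →L[ℂ] H) (V : X → H →L[ℂ] 𝒦) : Prop :=
  (∀ x y, K x y = KreinSpace.sharp (V x) ∘L V y) ∧
    Dense ((⨆ x, LinearMap.range (V x : H →ₗ[ℂ] 𝒦) : Submodule ℂ 𝒦) : Set 𝒦)

end Kernels

section Invariance

variable {S : Type*} [Group S] {X : Type*} [MulAction S X]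

/-- The standing assumptions on the weight `α : S × X → ℂ` for an action of the group `S` on `X`
(with involution `a ↦ a⁻¹`). The action `φ(a, x)` is written `a • x`. -/
structure IsWeight (α : S → X → ℂ) : Prop where
  ne_zero : ∀ a x, α a x ≠ 0
  mul_conj : ∀ a b x y, α (a * b) x * conj (α (a * b) y) =
    α a (b • x) * conj (α a (b • y)) * (α b x * conj (α b y))
  map_mul_inv : ∀ a x, α (a * a⁻¹) x = 1

open Classical in
/-- `σ(a, b) = α(a, φ(b, x))⁻¹ α(b, x)⁻¹ α(ab, x)`, which does not depend on `x ∈ X`, see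
`cocycle_eq`. (The value is irrelevant when `X` is empty; it is set to `1`.) -/
noncomputable def cocycle (α : S → X → ℂ) (a b : S) : ℂ :=
  if h : Nonempty X then
    (α a (b • h.some))⁻¹ * (α b h.some)⁻¹ * α (a * b) h.some
  else 1

theorem IsWeight.cocycle_eq {α : S → X → ℂ} (hα : IsWeight α) (a b : S) (x : X) :
    cocycle α a b = (α a (b • x))⁻¹ * (α b x)⁻¹ * α (a * b) x := by
  have hne : Nonempty X := ⟨x⟩
  have key : ∀ y z : X, (α a (b • y))⁻¹ * (α b y)⁻¹ * α (a * b) y =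
      (α a (b • z))⁻¹ * (α b z)⁻¹ * α (a * b) z := by
    intro y z
    have h1 := hα.mul_conj a b y z
    have h2 := hα.mul_conj a b z z
    have hc : conj (α (a * b) z) ≠ 0 := by simpa using hα.ne_zero (a * b) z
    have n1 := hα.ne_zero a (b • y)
    have n2 := hα.ne_zero b y
    have n3 := hα.ne_zero a (b • z)
    have n4 := hα.ne_zero b z
    apply mul_right_cancel₀ hc
    rw [mul_assoc, mul_assoc _ (α (a * b) z), h1, h2]
    field_simp
  rw [cocycle, dif_pos hne]
  exact key _ _

variable {H : Type*} [NormedAddCommGroup H] [InnerProductSpace ℂ H]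
  [CompleteSpace H] [KreinSpace H]

/-- `φ`-invariance of a kernel, for the involution `a ↦ a⁻¹` of the group `S`. -/
def IsInvariantKernel (α : S → X → ℂ) (K : X → X → H →L[ℂ] H) : Prop :=
  ∀ (a : S) (x y : X),
    K x (a • y) = (conj (α a (a⁻¹ • x)) * α a y) • K (a⁻¹ • x) y

end Invariance

section Representations

variable {S : Type*} [Group S]

/-- `U` is a projective representation with multiplier `σ`. -/
def IsProjectiveRep {E : Type*} [NormedAddCommGroup E] [NormedSpace ℂ E]
    (σ : S → S → ℂ) (U : S → E →L[ℂ] E) : Prop :=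
  ∀ a b, U a ∘L U b = σ a b • U (a * b)

/-- A symmetric projective representation on a Krein space. -/
def IsSymmetricProjectiveRep {E : Type*} [NormedAddCommGroup E] [InnerProductSpace ℂ E]
    [CompleteSpace E] [KreinSpace E] (σ : S → S → ℂ) (U : S → E →L[ℂ] E) : Prop :=
  IsProjectiveRep σ U ∧ ∀ a, KreinSpace.sharp (U a) = conj (σ a⁻¹ a) • U a⁻¹

/-- A symmetric projective representation on a Hilbert space (with the Hilbert space adjoint). -/
def IsHilbertSymmetricProjectiveRep {E : Type*} [NormedAddCommGroup E]
    [InnerProductSpace ℂ E] [CompleteSpace E] (σ : S → S → ℂ) (T : S → E →L[ℂ] E) : Prop :=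
  IsProjectiveRep σ T ∧ ∀ a, ContinuousLinearMap.adjoint (T a) = conj (σ a⁻¹ a) • T a⁻¹

/-- Similarity of families of operators, through a boundedly invertible `Φ`. -/
def AreSimilar {E F : Type*} [NormedAddCommGroup E] [NormedSpace ℂ E]
    [NormedAddCommGroup F] [NormedSpace ℂ F] (U : S → E →L[ℂ] E) (T : S → F →L[ℂ] F) : Prop :=
  ∃ Φ : E ≃L[ℂ] F, ∀ a, T a ∘L (Φ : E →L[ℂ] F) = (Φ : E →L[ℂ] F) ∘L U a

end Representations

/-! Everything reduces to operators on a Hilbert space. A positive definite kernel factors as `J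
V(x)* V(y)` with `V` total in a Hilbert space `G`; the leading `J` cancels the one in the indefinite
form. Bounded self-adjoint operators `A` on `G` then correspond faithfully, order included, to the
kernels `J V(x)* A V(y)`, and every positive definite kernel below a multiple of the original one is
of this kind. If the original kernel is invariant, translation gives unitaries `U(a)`, and
invariance of the kernel of `A` means that `A` commutes with them.

1 → 3: K is the kernel of a self-adjoint `A` commuting with every `U(a)`. So `A⁺` and `A⁻` commute
with them as well, and `A⁺ A⁻ = 0` makes their kernels disjoint.

3 → 2: put the Hilbert spaces of the two kernels into a direct sum with symmetry `1 ⊕ -1`.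
Disjointness is exactly what density requires: a vector orthogonal to the joint column yields, up to
scale, a rank-one kernel below both. The direct sum of the two unitary representations is symmetric
for both inner products, so the similarity is the identity.

2 → 1: transport `V` by the similarity into the Hilbert space, where the representation is unitary.
A large multiple of the resulting Gram kernel is invariant and dominates K. -/

open ContinuousLinearMap InnerProductSpace

/-! ### Kernels as compressions of operators -/

section Compression

variable {X : Type*} {H : Type*} [NormedAddCommGroup H] [InnerProductSpace ℂ H]
variable {G : Type*} [NormedAddCommGroup G] [InnerProductSpace ℂ G]

/-- The map `f ↦ ∑ₓ V(x) f(x)` on finitely supported functions. -/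
noncomputable def synthesis (V : X → H →L[ℂ] G) : (X →₀ H) →ₗ[ℂ] G :=
  Finsupp.lsum ℂ fun x => (V x : H →ₗ[ℂ] G)

theorem synthesis_apply (V : X → H →L[ℂ] G) (f : X →₀ H) :
    synthesis V f = f.sum fun x h => V x h := rfl

@[simp]
theorem synthesis_single (V : X → H →L[ℂ] G) (x : X) (h : H) :
    synthesis V (Finsupp.single x h) = V x h := by
  simp [synthesis]

theorem range_synthesis (V : X → H →L[ℂ] G) :
    LinearMap.range (synthesis V) = ⨆ x, LinearMap.range (V x : H →ₗ[ℂ] G) := by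
  apply le_antisymm
  · rintro _ ⟨f, rfl⟩
    rw [synthesis_apply]
    exact Submodule.sum_mem _ fun x _ => Submodule.mem_iSup_of_mem x ⟨f x, rfl⟩
  · refine iSup_le fun x => ?_
    rintro _ ⟨h, rfl⟩
    exact ⟨Finsupp.single x h, synthesis_single V x h⟩

theorem denseRange_synthesis_iff (V : X → H →L[ℂ] G) :
    DenseRange (synthesis V) ↔
      Dense ((⨆ x, LinearMap.range (V x : H →ₗ[ℂ] G) : Submodule ℂ G) : Set G) := by
  rw [← range_synthesis, DenseRange, LinearMap.coe_range]

theorem synthesis_comp {G' : Type*} [NormedAddCommGroup G'] [InnerProductSpace ℂ G']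
    (C : G →L[ℂ] G') (V : X → H →L[ℂ] G) (f : X →₀ H) :
    synthesis (fun x => C ∘L V x) f = C (synthesis V f) := by
  simp [synthesis_apply, Finsupp.sum, map_sum]

/-- A bounded operator is determined by its values on the ranges of a total family. -/
theorem eq_of_comp_eq {G' : Type*} [NormedAddCommGroup G'] [InnerProductSpace ℂ G']
    {V : X → H →L[ℂ] G} (hV : DenseRange (synthesis V)) {C D : G →L[ℂ] G'}
    (h : ∀ x, C ∘L V x = D ∘L V x) : C = D := by
  refine DFunLike.coe_injective (hV.equalizer C.continuous D.continuous ?_)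
  funext f
  simp only [Function.comp_apply, ← synthesis_comp, h]

/-- Domination of syntheses produces a bounded intertwiner. -/
theorem exists_comp_eq_of_norm_le {G' : Type*} [NormedAddCommGroup G'] [InnerProductSpace ℂ G']
    [CompleteSpace G'] {V : X → H →L[ℂ] G} (hV : DenseRange (synthesis V))
    (W : X → H →L[ℂ] G') (c : ℝ) (h : ∀ f, ‖synthesis W f‖ ≤ c * ‖synthesis V f‖) :
    ∃ C : G →L[ℂ] G', ∀ x, C ∘L V x = W x := by
  refine ⟨(synthesis W).extendOfNorm (synthesis V), fun x => ?_⟩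
  ext k
  have := LinearMap.extendOfNorm_eq hV ⟨c, h⟩ (Finsupp.single x k)
  simpa using this

variable [CompleteSpace H] [KreinSpace H] [CompleteSpace G]

/-- The kernel `(x, y) ↦ J V(x)* A V(y)`. -/
noncomputable def compressedKernel (V : X → H →L[ℂ] G) (A : G →L[ℂ] G) : X → X → H →L[ℂ] H :=
  fun x y => KreinSpace.J ∘L adjoint (V x) ∘L A ∘L V y

theorem form_compressedKernel (V : X → H →L[ℂ] G) (A : G →L[ℂ] G) (x y : X) (h k : H) :
    KreinSpace.form (compressedKernel V A x y h) k = inner ℂ (V x k) (A (V y h)) := by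
  simp [KreinSpace.form, compressedKernel, KreinSpace.J_J, adjoint_inner_right]

theorem kernelForm_eq_sum (K : X → X → H →L[ℂ] H) (f g : X →₀ H) :
    kernelForm K f g = g.sum fun x k => f.sum fun y h => KreinSpace.form (K x y h) k := rfl

theorem kernelForm_compressedKernel (V : X → H →L[ℂ] G) (A : G →L[ℂ] G) (f g : X →₀ H) :
    kernelForm (compressedKernel V A) f g = inner ℂ (synthesis V g) (A (synthesis V f)) := by
  simp only [kernelForm_eq_sum, form_compressedKernel, synthesis_apply, Finsupp.sum, map_sum,
    sum_inner, inner_sum]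
  exact Finset.sum_comm

theorem form_left_injective {a b : H} (h : ∀ k, KreinSpace.form a k = KreinSpace.form b k) :
    a = b := by
  rw [← KreinSpace.J_J a, ← KreinSpace.J_J b]
  exact congrArg _ (ext_inner_left ℂ h)

theorem kernel_ext_form {K L : X → X → H →L[ℂ] H}
    (h : ∀ x y h k, KreinSpace.form (K x y h) k = KreinSpace.form (L x y h) k) : K = L := by
  funext x y
  ext a
  exact form_left_injective (h x y a)

theorem compressedKernel_sub (V : X → H →L[ℂ] G) (A B : G →L[ℂ] G) :
    compressedKernel V (A - B) = compressedKernel V A - compressedKernel V B := by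
  funext x y
  simp [compressedKernel]

theorem compressedKernel_zero (V : X → H →L[ℂ] G) : compressedKernel V 0 = 0 := by
  funext x y
  simp [compressedKernel]

theorem compressedKernel_comp {G' : Type*} [NormedAddCommGroup G'] [InnerProductSpace ℂ G']
    [CompleteSpace G'] (V : X → H →L[ℂ] G) (C : G →L[ℂ] G') (A : G' →L[ℂ] G') :
    compressedKernel (fun x => C ∘L V x) A = compressedKernel V (adjoint C ∘L A ∘L C) :=
  kernel_ext_form fun x y h k => by
    simp [form_compressedKernel, adjoint_inner_right]

/-- The kernel records the sesquilinear form of `A` on a dense subspace, and boundedness does the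
rest. -/
theorem compressedKernel_injective {V : X → H →L[ℂ] G} (hV : DenseRange (synthesis V)) :
    Function.Injective (compressedKernel V) := by
  intro A B h
  refine eq_of_comp_eq hV fun y => ?_
  ext k
  refine hV.eq_of_inner_right ℂ fun f => ?_
  have := congrArg (fun P => kernelForm P (Finsupp.single y k) f) h
  simpa [kernelForm_compressedKernel] using this

theorem isHermitianKernel_compressedKernel (V : X → H →L[ℂ] G) {A : G →L[ℂ] G}
    (hA : IsSelfAdjoint A) : IsHermitianKernel (compressedKernel V A) := by
  intro x y
  refine KreinSpace.eq_sharp _ _ fun a b => ?_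
  rw [← KreinSpace.form_conj (compressedKernel V A x y b) a, form_compressedKernel,
    form_compressedKernel, inner_conj_symm]
  exact (ContinuousLinearMap.isSelfAdjoint_iff_isSymmetric.1 hA _ _).symm

theorem isPosDefKernel_compressedKernel (V : X → H →L[ℂ] G) {A : G →L[ℂ] G}
    (hA : A.IsPositive) : IsPosDefKernel (compressedKernel V A) :=
  ⟨isHermitianKernel_compressedKernel V hA.isSelfAdjoint, fun f => by
    rw [kernelForm_compressedKernel]
    exact hA.re_inner_nonneg_right _⟩

theorem isPosDefKernel_compressedKernel_one (V : X → H →L[ℂ] G) :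
    IsPosDefKernel (compressedKernel V 1) :=
  isPosDefKernel_compressedKernel V isPositive_one

theorem re_kernelForm_compressedKernel_one (V : X → H →L[ℂ] G) (f : X →₀ H) :
    (kernelForm (compressedKernel V 1) f f).re = ‖synthesis V f‖ ^ 2 := by
  rw [kernelForm_compressedKernel]
  exact inner_self_eq_norm_sq (𝕜 := ℂ) _

theorem le_of_kernelLE_compressedKernel {V : X → H →L[ℂ] G} (hV : DenseRange (synthesis V))
    {A B : G →L[ℂ] G} (hA : IsSelfAdjoint A) (hB : IsSelfAdjoint B)
    (h : KernelLE (compressedKernel V A) (compressedKernel V B)) : A ≤ B := by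
  rw [ContinuousLinearMap.le_def, ContinuousLinearMap.isPositive_def']
  refine ⟨hB.sub hA, fun x => ?_⟩
  refine hV.induction_on x
    (isClosed_le continuous_const (reApplyInnerSelf_continuous _)) fun f => ?_
  have := h f
  rw [kernelForm_compressedKernel, kernelForm_compressedKernel] at this
  rw [reApplyInnerSelf_apply, inner_re_symm, sub_apply, inner_sub_right, map_sub]
  exact sub_nonneg.2 this

end Compression

/-! ### Additivity of the kernel form -/

section KernelForm

variable {X : Type*} {H : Type*} [NormedAddCommGroup H] [InnerProductSpace ℂ H]
  [CompleteSpace H] [KreinSpace H]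

theorem kernelForm_add (A B : X → X → H →L[ℂ] H) (f g : X →₀ H) :
    kernelForm (A + B) f g = kernelForm A f g + kernelForm B f g := by
  simp [kernelForm, KreinSpace.form, Finset.sum_add_distrib]

theorem kernelForm_neg (A : X → X → H →L[ℂ] H) (f g : X →₀ H) :
    kernelForm (-A) f g = -kernelForm A f g := by
  simp [kernelForm, KreinSpace.form]

theorem IsHermitianKernel.add {A B : X → X → H →L[ℂ] H} (hA : IsHermitianKernel A)
    (hB : IsHermitianKernel B) : IsHermitianKernel (A + B) := by
  intro x y
  rw [Pi.add_apply, Pi.add_apply, hA x y, hB x y]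
  simp [KreinSpace.sharp]

end KernelForm

/-! ### Hilbert space factorization and domination -/

section Factorization

variable {X : Type u} {H : Type w} [NormedAddCommGroup H] [InnerProductSpace ℂ H]
  [CompleteSpace H] [KreinSpace H]

/-- Every positive definite kernel has a Kolmogorov decomposition through a Hilbert space. -/
theorem IsPosDefKernel.exists_factorization {L : X → X → H →L[ℂ] H} (hL : IsPosDefKernel L) :
    ∃ (G : Type (max u w)) (_ : NormedAddCommGroup G) (_ : InnerProductSpace ℂ G)
      (_ : CompleteSpace G) (V : X → H →L[ℂ] G),
      DenseRange (synthesis V) ∧ L = compressedKernel V 1 := by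
  -- Multiplying by `J` turns the indefinite form into the Hilbert inner product, so the reproducing
  -- kernel space of `M` is available.
  let M : Matrix X X (H →L[ℂ] H) := .of fun x y => KreinSpace.J ∘L L x y
  have hM : M.PosSemidef := by
    have htfae : M.PosSemidef ↔ _ := (RKHS.posSemidef_tfae (K := M)).out 0 2
    refine htfae.2 ⟨?_, fun f => ?_⟩
    · ext x y : 1
      rw [Matrix.conjTranspose_apply, star_eq_adjoint]
      simp only [M, Matrix.of_apply]
      rw [adjoint_comp, KreinSpace.adjoint_J, hL.1 x y, KreinSpace.sharp, ← comp_assoc,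
        KreinSpace.J_comp_J, id_comp]
    · have key : (f.sum fun x k => f.sum fun x' k' => inner ℂ (M x' x k) k') =
          conj (kernelForm L f f) := by
        rw [kernelForm_eq_sum, Finsupp.sum_comm]
        simp only [Finsupp.sum, map_sum, KreinSpace.form, inner_conj_symm]
        rfl
      rw [key]
      simpa using hL.2 f
  have : Fact M.PosSemidef := ⟨hM⟩
  refine ⟨RKHS.OfKernel M, inferInstance, inferInstance, inferInstance,
    fun x => RKHS.kerFun (RKHS.OfKernel M) x, ?_, ?_⟩
  · rw [denseRange_synthesis_iff, Submodule.dense_iff_topologicalClosure_eq_top]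
    refine top_le_iff.1 ((RKHS.kerFun_dense (RKHS.OfKernel M)).symm.le.trans
      (Submodule.topologicalClosure_mono (Submodule.span_le.2 ?_)))
    rintro _ ⟨x, k, rfl⟩
    exact Submodule.mem_iSup_of_mem x ⟨k, rfl⟩
  · funext x y
    have h : M x y = _ := congrFun (congrFun (RKHS.OfKernel.kernel_ofKernel (K := M)).symm x) y
    rw [RKHS.kernel_apply] at h
    have h2 : KreinSpace.J ∘L M x y = L x y := by
      simp only [M, Matrix.of_apply]
      rw [← comp_assoc, KreinSpace.J_comp_J, id_comp]
    rw [← h2, h]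
    rfl

/-- A positive definite kernel dominated by a factored kernel is a compression of a positive
operator on the same Hilbert space. -/
theorem IsPosDefKernel.exists_eq_compressedKernel {G : Type*} [NormedAddCommGroup G]
    [InnerProductSpace ℂ G] [CompleteSpace G] {V : X → H →L[ℂ] G}
    (hV : DenseRange (synthesis V)) {P : X → X → H →L[ℂ] H} (hP : IsPosDefKernel P) (c : ℝ)
    (hc : ∀ f, (kernelForm P f f).re ≤ c * ‖synthesis V f‖ ^ 2) :
    ∃ B : G →L[ℂ] G, B.IsPositive ∧ P = compressedKernel V B := by
  obtain ⟨G', _, _, _, W, -, rfl⟩ := hP.exists_factorization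
  -- The domination reads `‖W f‖² ≤ c ‖V f‖²`, so `W = C V` for a bounded `C`, and `C* C` is the
  -- required operator.
  obtain ⟨C, hC⟩ := exists_comp_eq_of_norm_le hV W (√c) fun f => by
    have h := hc f
    rw [re_kernelForm_compressedKernel_one] at h
    have := Real.sqrt_le_sqrt h
    rwa [Real.sqrt_sq (norm_nonneg _), Real.sqrt_mul' _ (sq_nonneg _),
      Real.sqrt_sq (norm_nonneg _)] at this
  refine ⟨adjoint C ∘L C, isPositive_adjoint_comp_self C, ?_⟩
  obtain rfl : (fun x => C ∘L V x) = W := funext hC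
  exact compressedKernel_comp V C 1

end Factorization

/-- Write `b = c* c`. Conjugating `b ≤ n` by `p` gives `p c* c p ≤ p n p = 0`, so `c p = 0`.
Conjugating `b ≤ p` by `c` then gives `(c c*)² ≤ c p c* = 0`, so `c = 0`. -/
theorem eq_zero_of_nonneg_of_le_of_le {A : Type*} [CStarAlgebra A] [PartialOrder A]
    [StarOrderedRing A] {b p n : A} (hb : 0 ≤ b) (hp : b ≤ p) (hn : b ≤ n) (h : p * n = 0) :
    b = 0 := by
  obtain ⟨c, rfl⟩ := CStarAlgebra.nonneg_iff_eq_star_mul_self.1 hb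
  have hps : star p = p := (IsSelfAdjoint.of_nonneg (hb.trans hp)).star_eq
  have h1 : c * p = 0 := by
    have h2 := star_left_conjugate_le_conjugate hn p
    rw [hps, h, zero_mul] at h2
    refine CStarRing.star_mul_self_eq_zero_iff _ |>.1 (le_antisymm ?_ (star_mul_self_nonneg _))
    simpa [hps, mul_assoc] using h2
  have h3 := star_right_conjugate_le_conjugate hp c
  rw [h1, zero_mul] at h3
  have h4 : c * star c = 0 := by
    refine CStarRing.star_mul_self_eq_zero_iff _ |>.1 (le_antisymm ?_ (star_mul_self_nonneg _))
    simpa [mul_assoc] using h3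
  rw [(CStarRing.mul_star_self_eq_zero_iff c).1 h4, mul_zero]

/-! ### The multiplier -/

section Cocycle

variable {S : Type*} [Group S] {X : Type*} [MulAction S X] {α : S → X → ℂ}

theorem IsWeight.map_one (hα : IsWeight α) (x : X) : α 1 x = 1 := by
  simpa using hα.map_mul_inv 1 x

theorem IsWeight.map_mul (hα : IsWeight α) (a b : S) (x : X) :
    α (a * b) x = cocycle α a b * α a (b • x) * α b x := by
  have h1 := hα.ne_zero a (b • x)
  have h2 := hα.ne_zero b x
  rw [hα.cocycle_eq a b x]
  field_simp

theorem cocycle_of_isEmpty [IsEmpty X] (a b : S) : cocycle α a b = 1 :=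
  dif_neg (not_nonempty_iff.2 ‹_›)

/-- The weight identity on the diagonal says that `|α|` is multiplicative, which forces the
multiplier to have modulus one. -/
theorem IsWeight.conj_cocycle_mul_cocycle (hα : IsWeight α) (a b : S) :
    conj (cocycle α a b) * cocycle α a b = 1 := by
  rcases isEmpty_or_nonempty X with h | ⟨⟨x⟩⟩
  · simp [cocycle_of_isEmpty]
  have h1 := hα.ne_zero a (b • x)
  have h2 := hα.ne_zero b x
  have h3 : conj (α a (b • x)) ≠ 0 := by simpa using h1
  have h4 : conj (α b x) ≠ 0 := by simpa using h2
  have h := hα.mul_conj a b x x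
  rw [hα.map_mul] at h
  simp only [_root_.map_mul] at h
  have hne := mul_ne_zero (mul_ne_zero h1 h3) (mul_ne_zero h2 h4)
  apply mul_right_cancel₀ hne
  linear_combination h

/-- Evaluating one side at `a • x` and the other at `x` produces the same two factors, since `α 1 =
1`. -/
theorem IsWeight.cocycle_mul_inv (hα : IsWeight α) (a : S) :
    cocycle α a a⁻¹ = cocycle α a⁻¹ a := by
  rcases isEmpty_or_nonempty X with h | ⟨⟨x⟩⟩
  · simp [cocycle_of_isEmpty]
  · rw [hα.cocycle_eq a a⁻¹ (a • x), hα.cocycle_eq a⁻¹ a x]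
    simp [hα.map_one, mul_comm]

end Cocycle

/-! ### Invariance and covariant representations -/

section Invariant

variable {S : Type*} [Group S] {X : Type*} [MulAction S X] {α : S → X → ℂ}
variable {H : Type*} [NormedAddCommGroup H] [InnerProductSpace ℂ H]

theorem isInvariantKernel_iff {K : X → X → H →L[ℂ] H} :
    IsInvariantKernel α K ↔
      ∀ a x y, K (a • x) (a • y) = (conj (α a x) * α a y) • K x y := by
  refine ⟨fun h a x y => ?_, fun h a x y => ?_⟩
  · simpa using h a (a • x) y
  · simpa using h a (a⁻¹ • x) y

variable {G : Type*} [NormedAddCommGroup G] [InnerProductSpace ℂ G]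
  {V : X → H →L[ℂ] G} {U : S → G →L[ℂ] G}

/-- The identity acts as the identity, once the family `V` is total. -/
theorem eq_one_of_covariant (hα : IsWeight α)
    (hU : ∀ a x, V (a • x) = α a x • (U a ∘L V x)) (hV : DenseRange (synthesis V)) :
    U 1 = 1 :=
  eq_of_comp_eq hV fun x => by
    have := hU 1 x
    rw [one_smul, hα.map_one, one_smul] at this
    exact this.symm

/-- Expanding `V((ab) • x)` at once and in two stages identifies both sides on a total family. -/
theorem isProjectiveRep_of_covariant (hα : IsWeight α)
    (hU : ∀ a x, V (a • x) = α a x • (U a ∘L V x)) (hV : DenseRange (synthesis V)) :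
    IsProjectiveRep (cocycle α) U := by
  intro a b
  refine eq_of_comp_eq hV fun x => ?_
  have h := hU (a * b) x
  rw [mul_smul, hU, hU, hα.map_mul, comp_smul, smul_smul] at h
  have hne := mul_ne_zero (hα.ne_zero a (b • x)) (hα.ne_zero b x)
  refine smul_right_injective _ hne ?_
  simp only
  rw [comp_assoc, h, smul_comp, smul_smul]
  congr 1
  ring

variable [CompleteSpace H] [KreinSpace H] [CompleteSpace G]

theorem form_smul_left (c : ℂ) (p q : H) :
    KreinSpace.form (c • p) q = c * KreinSpace.form p q := by
  simp [KreinSpace.form]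

theorem form_compressedKernel_one (V : X → H →L[ℂ] G) (x y : X) (h k : H) :
    KreinSpace.form (compressedKernel V 1 x y h) k = inner ℂ (V x k) (V y h) :=
  form_compressedKernel V 1 x y h k

theorem compressedKernel_smul_smul (hU : ∀ a x, V (a • x) = α a x • (U a ∘L V x))
    (A : G →L[ℂ] G) (a : S) (x y : X) :
    compressedKernel V A (a • x) (a • y) =
      (conj (α a x) * α a y) • compressedKernel V (adjoint (U a) ∘L A ∘L U a) x y := by
  ext h
  refine form_left_injective fun k => ?_
  rw [smul_apply, form_smul_left, form_compressedKernel, form_compressedKernel, hU, hU]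
  simp only [smul_apply, comp_apply, map_smul, inner_smul_left, inner_smul_right,
    adjoint_inner_right]
  ring

theorem isInvariantKernel_compressedKernel (hU : ∀ a x, V (a • x) = α a x • (U a ∘L V x))
    {A : G →L[ℂ] G} (hA : ∀ a, adjoint (U a) ∘L A ∘L U a = A) :
    IsInvariantKernel α (compressedKernel V A) :=
  isInvariantKernel_iff.2 fun a x y => by rw [compressedKernel_smul_smul hU, hA]

/-- Translation conjugates the operator by `U(a)` and produces precisely the invariance factor,
which cancels. For `A = 1` the conclusion says that `U(a)` is isometric. -/
theorem conj_eq_of_isInvariantKernel (hα : IsWeight α)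
    (hU : ∀ a x, V (a • x) = α a x • (U a ∘L V x)) (hV : DenseRange (synthesis V))
    {A : G →L[ℂ] G} (hA : IsInvariantKernel α (compressedKernel V A)) (a : S) :
    adjoint (U a) ∘L A ∘L U a = A := by
  refine compressedKernel_injective hV ?_
  funext x y
  have h := isInvariantKernel_iff.1 hA a x y
  rw [compressedKernel_smul_smul hU] at h
  exact smul_right_injective _
    (mul_ne_zero (by simpa using hα.ne_zero a x) (hα.ne_zero a y)) h

/-- Projective representations preserving the inner product are symmetric. -/
theorem IsProjectiveRep.isHilbertSymmetric (hα : IsWeight α)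
    (hU : IsProjectiveRep (cocycle α) U) (h1 : U 1 = 1)
    (hiso : ∀ a, adjoint (U a) ∘L U a = 1) :
    IsHilbertSymmetricProjectiveRep (cocycle α) U := by
  refine ⟨hU, fun a => ?_⟩
  have h := hU a a⁻¹
  rw [mul_inv_cancel, h1, hα.cocycle_mul_inv] at h
  calc adjoint (U a) = (conj (cocycle α a⁻¹ a) * cocycle α a⁻¹ a) • adjoint (U a) := by
        rw [hα.conj_cocycle_mul_cocycle, one_smul]
    _ = conj (cocycle α a⁻¹ a) • (adjoint (U a) ∘L (cocycle α a⁻¹ a • 1)) := by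
        rw [comp_smul, smul_smul]; rfl
    _ = conj (cocycle α a⁻¹ a) • U a⁻¹ := by
        rw [← h, ← comp_assoc, hiso]; rfl

/-- Symmetry alone gives `U(a)* U(a) = U(1)`, which may be a proper projection; hence the hypothesis
on `U 1`. -/
theorem IsHilbertSymmetricProjectiveRep.adjoint_comp_self (hα : IsWeight α)
    (hU : IsHilbertSymmetricProjectiveRep (cocycle α) U) (h1 : U 1 = 1) (a : S) :
    adjoint (U a) ∘L U a = 1 := by
  rw [hU.2, smul_comp, hU.1, inv_mul_cancel, h1, smul_smul, hα.conj_cocycle_mul_cocycle,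
    one_smul]

theorem IsHilbertSymmetricProjectiveRep.comp_adjoint_self (hα : IsWeight α)
    (hU : IsHilbertSymmetricProjectiveRep (cocycle α) U) (h1 : U 1 = 1) (a : S) :
    U a ∘L adjoint (U a) = 1 := by
  rw [hU.2, comp_smul, hU.1, mul_inv_cancel, h1, smul_smul, hα.cocycle_mul_inv,
    hα.conj_cocycle_mul_cocycle, one_smul]

/-- An invariant positive definite kernel carries a covariant symmetric projective
representation on its Hilbert space. -/
theorem exists_covariant_rep (hα : IsWeight α) (hV : DenseRange (synthesis V))
    (hL : IsInvariantKernel α (compressedKernel V 1)) :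
    ∃ U : S → G →L[ℂ] G, (∀ a x, V (a • x) = α a x • (U a ∘L V x)) ∧
      IsHilbertSymmetricProjectiveRep (cocycle α) U ∧ U 1 = 1 := by
  have hex : ∀ a : S, ∃ C : G →L[ℂ] G, ∀ x, C ∘L V x = (α a x)⁻¹ • V (a • x) := by
    intro a
    refine exists_comp_eq_of_norm_le hV _ 1 fun f => ?_
    -- Invariance says that the rescaled translate has the same Gram kernel as `V`, so the two
    -- syntheses have equal norms.
    have hker : compressedKernel (fun x => (α a x)⁻¹ • V (a • x)) 1 = compressedKernel V 1 := by
      refine kernel_ext_form fun x y h k => ?_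
      have := congrArg (fun T => KreinSpace.form (T h) k) (isInvariantKernel_iff.1 hL a x y)
      have h1 : conj (α a x) ≠ 0 := by simpa using hα.ne_zero a x
      have h2 := hα.ne_zero a y
      simp only [smul_apply, form_smul_left, form_compressedKernel_one] at this
      simp only [form_compressedKernel_one, smul_apply, inner_smul_left, inner_smul_right,
        this, map_inv₀]
      field_simp
    have hsq := re_kernelForm_compressedKernel_one (fun x => (α a x)⁻¹ • V (a • x)) f
    rw [hker, re_kernelForm_compressedKernel_one] at hsq
    rw [one_mul]
    exact (sq_le_sq₀ (norm_nonneg _) (norm_nonneg _)).1 hsq.symm.le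
  choose U hU using hex
  have hcov : ∀ a x, V (a • x) = α a x • (U a ∘L V x) := fun a x => by
    rw [hU, smul_smul, mul_inv_cancel₀ (hα.ne_zero a x), one_smul]
  have h1 := eq_one_of_covariant hα hcov hV
  exact ⟨U, hcov, (isProjectiveRep_of_covariant hα hcov hV).isHilbertSymmetric hα h1
    fun a => conj_eq_of_isInvariantKernel hα hcov hV hL a, h1⟩

end Invariant

/-! ### Jordan decomposition of a dominated kernel -/

section Jordan

variable {S : Type v} [Group S] {X : Type u} [MulAction S X] {α : S → X → ℂ}
variable {H : Type w} [NormedAddCommGroup H] [InnerProductSpace ℂ H] [CompleteSpace H]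
  [KreinSpace H]

theorem re_kernelForm_compressedKernel_le {G : Type*} [NormedAddCommGroup G]
    [InnerProductSpace ℂ G] [CompleteSpace G] (V : X → H →L[ℂ] G) (A : G →L[ℂ] G) (f : X →₀ H) :
    |(kernelForm (compressedKernel V A) f f).re| ≤ ‖A‖ * ‖synthesis V f‖ ^ 2 := by
  rw [kernelForm_compressedKernel]
  refine (Complex.abs_re_le_norm _).trans ((norm_inner_le_norm _ _).trans ?_)
  have := mul_le_mul_of_nonneg_left (A.le_opNorm (synthesis V f)) (norm_nonneg (synthesis V f))
  linarith

/-- A common minorant is itself the kernel of a positive operator below both `p` and `n`, and such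
an operator vanishes. -/
theorem disjointKernels_compressedKernel {G : Type*} [NormedAddCommGroup G]
    [InnerProductSpace ℂ G] [CompleteSpace G] {V : X → H →L[ℂ] G}
    (hV : DenseRange (synthesis V)) {p n : G →L[ℂ] G} (hp : IsSelfAdjoint p)
    (hn : IsSelfAdjoint n) (h : p * n = 0) :
    DisjointKernels (compressedKernel V p) (compressedKernel V n) := by
  intro P hP h1 h2
  obtain ⟨B, hB, rfl⟩ := hP.exists_eq_compressedKernel hV ‖p‖ fun f =>
    (h1 f).trans ((le_abs_self _).trans (re_kernelForm_compressedKernel_le V p f))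
  have h0 : B = 0 := eq_zero_of_nonneg_of_le_of_le ((nonneg_iff_isPositive B).2 hB)
    (le_of_kernelLE_compressedKernel hV hB.isSelfAdjoint hp h1)
    (le_of_kernelLE_compressedKernel hV hB.isSelfAdjoint hn h2) h
  rw [h0, compressedKernel_zero]

theorem exists_disjoint_decomposition (hα : IsWeight α) {K L : X → X → H →L[ℂ] H}
    (hK : IsHermitianKernel K) (hKinv : IsInvariantKernel α K) (hL : IsPosDefKernel L)
    (hLinv : IsInvariantKernel α L) (h1 : KernelLE (-L) K) (h2 : KernelLE K L) :
    ∃ Kpos Kneg : X → X → H →L[ℂ] H, IsPosDefKernel Kpos ∧ IsPosDefKernel Kneg ∧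
      IsInvariantKernel α Kpos ∧ IsInvariantKernel α Kneg ∧
      DisjointKernels Kpos Kneg ∧ K = Kpos - Kneg := by
  obtain ⟨G, _, _, _, V, hV, rfl⟩ := hL.exists_factorization
  -- Shifting by L turns `-L ≤ K ≤ L` into `0 ≤ K + L ≤ 2L`, so the domination lemma applies with
  -- constant 2; subtracting `1` from the operator undoes the shift.
  have hsum : IsPosDefKernel (K + compressedKernel V 1) := by
    refine ⟨hK.add hL.1, fun f => ?_⟩
    have := h1 f
    rw [kernelForm_neg, Complex.neg_re] at this
    rw [kernelForm_add, Complex.add_re]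
    linarith
  obtain ⟨B, hB, hKB⟩ := hsum.exists_eq_compressedKernel hV 2 fun f => by
    have := h2 f
    rw [kernelForm_add, Complex.add_re]
    rw [re_kernelForm_compressedKernel_one] at this ⊢
    linarith
  obtain ⟨A, hA, rfl⟩ : ∃ A : G →L[ℂ] G, IsSelfAdjoint A ∧ K = compressedKernel V A :=
    ⟨B - 1, hB.isSelfAdjoint.sub (IsSelfAdjoint.one _), by
      rw [compressedKernel_sub, ← hKB, add_sub_cancel_right]⟩
  obtain ⟨U, hcov, hU, hU1⟩ := exists_covariant_rep hα hV hLinv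
  have hcomm : ∀ a, Commute A (U a) := fun a => by
    have h := congrArg (fun T => U a ∘L T) (conj_eq_of_isInvariantKernel hα hcov hV hKinv a)
    simp only [← comp_assoc] at h
    rw [hU.comp_adjoint_self hα hU1] at h
    exact h
  have hconj : ∀ (a : S) (T : G →L[ℂ] G), Commute T (U a) →
      adjoint (U a) ∘L T ∘L U a = T := fun a T hT => by
    have h : T ∘L U a = U a ∘L T := hT
    rw [h, ← comp_assoc, hU.adjoint_comp_self hα hU1]
    rfl
  have hpos : 0 ≤ A⁺ := CFC.posPart_nonneg A
  have hneg : 0 ≤ A⁻ := CFC.negPart_nonneg A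
  refine ⟨compressedKernel V A⁺, compressedKernel V A⁻,
    isPosDefKernel_compressedKernel V ((nonneg_iff_isPositive _).1 hpos),
    isPosDefKernel_compressedKernel V ((nonneg_iff_isPositive _).1 hneg),
    -- The positive and negative parts are functions of `A`, so they commute with whatever commutes
    -- with `A`.
    isInvariantKernel_compressedKernel hcov fun a => hconj a _ ((hcomm a).cfcₙ_real _),
    isInvariantKernel_compressedKernel hcov fun a => hconj a _ ((hcomm a).cfcₙ_real _),
    disjointKernels_compressedKernel hV (IsSelfAdjoint.of_nonneg hpos)
      (IsSelfAdjoint.of_nonneg hneg) (CFC.posPart_mul_negPart A), ?_⟩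
  rw [← compressedKernel_sub, CFC.posPart_sub_negPart A hA]

end Jordan

/-! ### Direct sums with symmetry `1 ⊕ -1` -/

section DirectSum

variable {G F : Type*} [NormedAddCommGroup G] [InnerProductSpace ℂ G]
  [NormedAddCommGroup F] [InnerProductSpace ℂ F]

/-- The operator `A ⊕ B` on the Hilbert space direct sum. -/
noncomputable def directSumMap (A : G →L[ℂ] G) (B : F →L[ℂ] F) :
    WithLp 2 (G × F) →L[ℂ] WithLp 2 (G × F) :=
  (WithLp.prodContinuousLinearEquiv 2 ℂ G F).symm ∘L (A.prodMap B) ∘L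
    (WithLp.prodContinuousLinearEquiv 2 ℂ G F : WithLp 2 (G × F) →L[ℂ] G × F)

theorem directSumMap_apply (A : G →L[ℂ] G) (B : F →L[ℂ] F) (z : WithLp 2 (G × F)) :
    directSumMap A B z = WithLp.toLp 2 (A z.fst, B z.snd) := rfl

theorem directSumMap_comp (A A' : G →L[ℂ] G) (B B' : F →L[ℂ] F) :
    directSumMap A B ∘L directSumMap A' B' = directSumMap (A ∘L A') (B ∘L B') := rfl

theorem directSumMap_smul (c : ℂ) (A : G →L[ℂ] G) (B : F →L[ℂ] F) :
    directSumMap (c • A) (c • B) = c • directSumMap A B := rfl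

theorem adjoint_directSumMap [CompleteSpace G] [CompleteSpace F] (A : G →L[ℂ] G)
    (B : F →L[ℂ] F) :
    adjoint (directSumMap A B) = directSumMap (adjoint A) (adjoint B) := by
  symm
  rw [eq_adjoint_iff]
  intro x y
  simp [directSumMap_apply, WithLp.prod_inner_apply, adjoint_inner_left]

/-- The direct sum `G ⊕ F` with the fundamental symmetry `1 ⊕ -1`. -/
noncomputable abbrev directSumKrein [CompleteSpace G] [CompleteSpace F] :
    KreinSpace (WithLp 2 (G × F)) where
  J := directSumMap 1 (-1)
  adjoint_J := by
    rw [adjoint_directSumMap, map_neg, ← star_eq_adjoint, ← star_eq_adjoint, star_one, star_one]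
  J_comp_J := by
    rw [directSumMap_comp]
    refine ContinuousLinearMap.ext fun z => ?_
    simp [directSumMap_apply]
    rfl

/-- The column `V ⊕ W` as a map into the direct sum. -/
noncomputable def directSumColumn {H : Type*} [NormedAddCommGroup H] [InnerProductSpace ℂ H]
    (V : H →L[ℂ] G) (W : H →L[ℂ] F) : H →L[ℂ] WithLp 2 (G × F) :=
  (WithLp.prodContinuousLinearEquiv 2 ℂ G F).symm ∘L (V.prod W)

theorem directSumColumn_apply {H : Type*} [NormedAddCommGroup H] [InnerProductSpace ℂ H]
    (V : H →L[ℂ] G) (W : H →L[ℂ] F) (h : H) :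
    directSumColumn V W h = WithLp.toLp 2 (V h, W h) := rfl

theorem directSumMap_comp_column {H : Type*} [NormedAddCommGroup H] [InnerProductSpace ℂ H]
    (A : G →L[ℂ] G) (B : F →L[ℂ] F) (V : H →L[ℂ] G) (W : H →L[ℂ] F) :
    directSumMap A B ∘L directSumColumn V W = directSumColumn (A ∘L V) (B ∘L W) := rfl

end DirectSum

/-! ### From disjointness to a Kreĭn space, and from similarity to domination -/

section Implications

variable {S : Type v} [Group S] {X : Type u} [MulAction S X] {α : S → X → ℂ}
variable {H : Type w} [NormedAddCommGroup H] [InnerProductSpace ℂ H] [CompleteSpace H]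
  [KreinSpace H]

/-- Disjointness makes the joint column total. -/
theorem DisjointKernels.dense_column {G F : Type*} [NormedAddCommGroup G]
    [InnerProductSpace ℂ G] [CompleteSpace G] [NormedAddCommGroup F] [InnerProductSpace ℂ F]
    [CompleteSpace F] {V : X → H →L[ℂ] G} {W : X → H →L[ℂ] F}
    (hV : DenseRange (synthesis V)) (hW : DenseRange (synthesis W))
    (h : DisjointKernels (compressedKernel V 1) (compressedKernel W 1)) :
    DenseRange (synthesis fun x => directSumColumn (V x) (W x)) := by
  rw [denseRange_synthesis_iff, ← range_synthesis, Submodule.dense_iff_topologicalClosure_eq_top,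
    Submodule.topologicalClosure_eq_top_iff, Submodule.eq_bot_iff]
  have hcol : ∀ f, synthesis (fun x => directSumColumn (V x) (W x)) f =
      WithLp.toLp 2 (synthesis V f, synthesis W f) := by
    intro f
    induction f using Finsupp.induction_linear with
    | zero =>
      simp only [map_zero]
      rfl
    | add f g hf hg => simp [hf, hg, ← WithLp.toLp_add]
    | single x k => simp [directSumColumn_apply]
  -- The bound `‖z‖ ≤ 1` puts the rank-one kernel below both kernels with constant one; general `z`
  -- follows by rescaling.
  have key : ∀ z ∈ (LinearMap.range (synthesis fun x => directSumColumn (V x) (W x)))ᗮ,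
      ‖z‖ ≤ 1 → z = 0 := by
    intro z hz hz1
    -- Orthogonality lets the same rank-one form be computed through `V` or through `W`, hence the
    -- two bounds.
    have horth : ∀ f, (inner ℂ (synthesis V f) z.fst : ℂ) = -inner ℂ (synthesis W f) z.snd := by
      intro f
      have := (Submodule.mem_orthogonal _ z).1 hz _ ⟨f, rfl⟩
      rw [hcol, WithLp.prod_inner_apply] at this
      exact eq_neg_of_add_eq_zero_left this
    have hn : ‖z‖ ^ 2 = ‖z.fst‖ ^ 2 + ‖z.snd‖ ^ 2 := WithLp.prod_norm_sq_eq_of_L2 z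
    have hz2 : ‖z‖ ^ 2 ≤ 1 := pow_le_one₀ (norm_nonneg _) hz1
    have hre : ∀ f, (kernelForm (compressedKernel V (rankOne ℂ z.fst z.fst)) f f).re =
        ‖(inner ℂ (synthesis V f) z.fst : ℂ)‖ ^ 2 := by
      intro f
      rw [kernelForm_compressedKernel, inner_right_rankOne_apply, ← inner_conj_symm z.fst,
        Complex.mul_conj]
      exact (Complex.ofReal_re _).trans (Complex.normSq_eq_norm_sq _)
    have hP := h (compressedKernel V (rankOne ℂ z.fst z.fst))
      (isPosDefKernel_compressedKernel V (isPositive_rankOne_self z.fst))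
      (fun f => by
        rw [hre, re_kernelForm_compressedKernel_one]
        refine pow_le_pow_left₀ (norm_nonneg _) ((norm_inner_le_norm _ _).trans ?_) 2
        exact mul_le_of_le_one_right (norm_nonneg _)
          ((sq_le_one_iff₀ (norm_nonneg _)).1 (by nlinarith [sq_nonneg ‖z.snd‖])))
      (fun f => by
        rw [hre, horth, norm_neg, re_kernelForm_compressedKernel_one]
        refine pow_le_pow_left₀ (norm_nonneg _) ((norm_inner_le_norm _ _).trans ?_) 2
        exact mul_le_of_le_one_right (norm_nonneg _)
          ((sq_le_one_iff₀ (norm_nonneg _)).1 (by nlinarith [sq_nonneg ‖z.fst‖])))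
    have hzero : ∀ f, (inner ℂ (synthesis V f) z.fst : ℂ) = 0 := by
      intro f
      have := hre f
      rw [hP] at this
      simpa [kernelForm, KreinSpace.form] using this.symm
    have h1 : z.fst = 0 := hV.eq_zero_of_inner_right ℂ hzero
    have h2 : z.snd = 0 := hW.eq_zero_of_inner_right ℂ fun f => by
      have := horth f
      rw [hzero] at this
      exact neg_eq_zero.1 this.symm
    rw [h1, h2] at hn
    simpa using hn
  intro z hz
  by_contra hne
  have hn : ‖z‖ ≠ 0 := norm_ne_zero_iff.2 hne
  have := key (((‖z‖⁻¹ : ℝ) : ℂ) • z) (Submodule.smul_mem _ _ hz) (by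
    rw [norm_smul, Complex.norm_real, norm_inv, norm_norm, inv_mul_cancel₀ hn])
  rcases smul_eq_zero.1 this with h0 | h0
  · exact hn (by simpa using h0)
  · exact hne h0

/-- The symmetry `1 ⊕ -1` commutes with block-diagonal operators, so the Kreĭn and Hilbert adjoints
of the representation agree. Disjointness enters only through density. -/
theorem exists_kolmogorov_of_disjoint_decomposition (hα : IsWeight α)
    {Kpos Kneg : X → X → H →L[ℂ] H} (hp : IsPosDefKernel Kpos) (hn : IsPosDefKernel Kneg)
    (hpi : IsInvariantKernel α Kpos) (hni : IsInvariantKernel α Kneg)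
    (hd : DisjointKernels Kpos Kneg) :
    ∃ (𝒦 : Type (max u w)) (_ : NormedAddCommGroup 𝒦) (_ : InnerProductSpace ℂ 𝒦)
      (_ : CompleteSpace 𝒦) (_ : KreinSpace 𝒦) (V : X → H →L[ℂ] 𝒦) (U : S → 𝒦 →L[ℂ] 𝒦),
      IsKolmogorovDecomposition (Kpos - Kneg) V ∧
      (∀ a x, V (a • x) = α a x • (U a ∘L V x)) ∧
      IsSymmetricProjectiveRep (cocycle α) U ∧
      IsHilbertSymmetricProjectiveRep (cocycle α) U := by
  obtain ⟨G, _, _, _, V, hV, rfl⟩ := hp.exists_factorization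
  obtain ⟨F, _, _, _, W, hW, rfl⟩ := hn.exists_factorization
  obtain ⟨U, hcU, hU, -⟩ := exists_covariant_rep hα hV hpi
  obtain ⟨T, hcT, hT, -⟩ := exists_covariant_rep hα hW hni
  let _ : KreinSpace (WithLp 2 (G × F)) := directSumKrein
  have hH : IsHilbertSymmetricProjectiveRep (cocycle α) fun a => directSumMap (U a) (T a) :=
    ⟨fun a b => by rw [directSumMap_comp, hU.1, hT.1, directSumMap_smul],
      fun a => by rw [adjoint_directSumMap, hU.2, hT.2, directSumMap_smul]⟩
  refine ⟨WithLp 2 (G × F), inferInstance, inferInstance, inferInstance, directSumKrein,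
    fun x => directSumColumn (V x) (W x), fun a => directSumMap (U a) (T a),
    ⟨fun x y => ?_, (denseRange_synthesis_iff _).1 (hd.dense_column hV hW)⟩, fun a x => ?_,
    ⟨hH.1, fun a => ?_⟩, hH⟩
  · ext h
    refine form_left_injective fun k => ?_
    change _ = KreinSpace.form
      (compressedKernel (fun x => directSumColumn (V x) (W x)) KreinSpace.J x y h) k
    have hsub : ∀ p q : H, KreinSpace.form (p - q) k = KreinSpace.form p k - KreinSpace.form q k :=
      fun p q => by simp [KreinSpace.form]
    rw [Pi.sub_apply, Pi.sub_apply, sub_apply, hsub, form_compressedKernel_one,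
      form_compressedKernel_one, form_compressedKernel]
    change _ = inner ℂ (directSumColumn (V x) (W x) k)
      (directSumMap 1 (-1) (directSumColumn (V y) (W y) h))
    simp [directSumMap_apply, directSumColumn_apply, WithLp.prod_inner_apply, sub_eq_add_neg]
  · simp only [hcU, hcT, directSumMap_comp_column]
    rfl
  · rw [KreinSpace.sharp, hH.2]
    have hJ : ∀ (A : G →L[ℂ] G) (B : F →L[ℂ] F),
        (KreinSpace.J : WithLp 2 (G × F) →L[ℂ] _) ∘L directSumMap A B ∘L KreinSpace.J =
          directSumMap A B := by
      intro A B
      change directSumMap 1 (-1) ∘L directSumMap A B ∘L directSumMap 1 (-1) = _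
      rw [directSumMap_comp, directSumMap_comp]
      congr 1
      ext z
      simp
    rw [smul_comp, comp_smul, hJ]

theorem exists_dominating_of_similar (hα : IsWeight α) {K : X → X → H →L[ℂ] H}
    {𝒦 : Type*} [NormedAddCommGroup 𝒦] [InnerProductSpace ℂ 𝒦] [CompleteSpace 𝒦]
    [KreinSpace 𝒦] {V : X → H →L[ℂ] 𝒦} {U : S → 𝒦 →L[ℂ] 𝒦}
    (hV : IsKolmogorovDecomposition K V) (hU : ∀ a x, V (a • x) = α a x • (U a ∘L V x))
    {𝒢 : Type*} [NormedAddCommGroup 𝒢] [InnerProductSpace ℂ 𝒢] [CompleteSpace 𝒢]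
    {T : S → 𝒢 →L[ℂ] 𝒢} (hT : IsHilbertSymmetricProjectiveRep (cocycle α : S → S → ℂ) T)
    (hUT : AreSimilar U T) :
    ∃ L : X → X → H →L[ℂ] H, IsPosDefKernel L ∧ IsInvariantKernel α L ∧
      KernelLE (-L) K ∧ KernelLE K L := by
  obtain ⟨Φ, hΦ⟩ := hUT
  have hdense := (denseRange_synthesis_iff V).2 hV.2
  have hK : K = compressedKernel V KreinSpace.J := funext fun x => funext fun y => by
    rw [hV.1 x y]
    rfl
  -- Totality of `V` forces `U 1 = 1`, and similarity carries this to `T`; with symmetry it makes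
  -- `T` unitary.
  have hT1 : T 1 = 1 := by
    ext z
    have h := congrArg (fun A => A (Φ.symm z)) (hΦ 1)
    rw [eq_one_of_covariant hα hU hdense] at h
    simpa using h
  -- The second factor compensates for the distortion of norms by `Φ`; the first suffices because
  -- `‖J‖ ≤ (1 + ‖J‖)²`.
  let c : ℝ := (1 + ‖(KreinSpace.J : 𝒦 →L[ℂ] 𝒦)‖) * ‖(Φ.symm : 𝒢 →L[ℂ] 𝒦)‖
  let W : X → H →L[ℂ] 𝒢 := fun x => ((c : ℂ) • (Φ : 𝒦 →L[ℂ] 𝒢)) ∘L V x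
  have hW : ∀ a x, W (a • x) = α a x • (T a ∘L W x) := fun a x => by
    have hs : T a ∘L ((c : ℂ) • (Φ : 𝒦 →L[ℂ] 𝒢)) = ((c : ℂ) • (Φ : 𝒦 →L[ℂ] 𝒢)) ∘L U a := by
      rw [comp_smul, hΦ, smul_comp]
    simp only [W]
    rw [hU, ← comp_assoc (T a), hs, comp_smul, comp_assoc]
  have hbound : ∀ f, |(kernelForm K f f).re| ≤ (kernelForm (compressedKernel W 1) f f).re := by
    intro f
    rw [re_kernelForm_compressedKernel_one, hK]
    refine (re_kernelForm_compressedKernel_le V _ f).trans ?_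
    have h1 : synthesis W f = (c : ℂ) • Φ (synthesis V f) := synthesis_comp _ V f
    have h2 : ‖synthesis V f‖ ≤ ‖(Φ.symm : 𝒢 →L[ℂ] 𝒦)‖ * ‖Φ (synthesis V f)‖ := by
      simpa using (Φ.symm : 𝒢 →L[ℂ] 𝒦).le_opNorm (Φ (synthesis V f))
    have hJ := norm_nonneg (KreinSpace.J : 𝒦 →L[ℂ] 𝒦)
    have hc : 0 ≤ c := by positivity
    have h3 : (1 + ‖(KreinSpace.J : 𝒦 →L[ℂ] 𝒦)‖) * ‖synthesis V f‖ ≤ ‖synthesis W f‖ := by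
      rw [h1, norm_smul, Complex.norm_real, Real.norm_of_nonneg hc, mul_assoc]
      exact mul_le_mul_of_nonneg_left h2 (by positivity)
    refine le_trans ?_ (pow_le_pow_left₀ (by positivity) h3 2)
    rw [mul_pow]
    refine mul_le_mul_of_nonneg_right ?_ (sq_nonneg _)
    nlinarith
  refine ⟨compressedKernel W 1, isPosDefKernel_compressedKernel_one W,
    isInvariantKernel_compressedKernel hW fun a => hT.adjoint_comp_self hα hT1 a,
    fun f => ?_, fun f => (le_abs_self _).trans (hbound f)⟩
  rw [kernelForm_neg, Complex.neg_re]
  exact neg_le.1 ((neg_le_abs _).trans (hbound f))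

end Implications

theorem mainTheorem4 {S : Type v} [Group S] {X : Type u} [MulAction S X]
    {H : Type w} [NormedAddCommGroup H] [InnerProductSpace ℂ H] [CompleteSpace H] [KreinSpace H]
    (α : S → X → ℂ) (hα : IsWeight α)
    (K : X → X → H →L[ℂ] H) (hK : IsHermitianKernel K) (hKinv : IsInvariantKernel α K) :
    List.TFAE [
      ∃ L : X → X → H →L[ℂ] H, IsPosDefKernel L ∧ IsInvariantKernel α L ∧
        KernelLE (-L) K ∧ KernelLE K L,
      ∃ (𝒦 : Type (max u w)) (_ : NormedAddCommGroup 𝒦) (_ : InnerProductSpace ℂ 𝒦)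
        (_ : CompleteSpace 𝒦) (_ : KreinSpace 𝒦) (V : X → H →L[ℂ] 𝒦) (U : S → 𝒦 →L[ℂ] 𝒦),
        IsKolmogorovDecomposition K V ∧
        (∀ a x, V (a • x) = α a x • (U a ∘L V x)) ∧
        IsSymmetricProjectiveRep (cocycle α) U ∧
        ∃ (𝒢 : Type (max u w)) (_ : NormedAddCommGroup 𝒢) (_ : InnerProductSpace ℂ 𝒢)
          (_ : CompleteSpace 𝒢) (T : S → 𝒢 →L[ℂ] 𝒢),
          IsHilbertSymmetricProjectiveRep (cocycle α : S → S → ℂ) T ∧ AreSimilar U T,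
      ∃ Kpos Kneg : X → X → H →L[ℂ] H, IsPosDefKernel Kpos ∧ IsPosDefKernel Kneg ∧
        IsInvariantKernel α Kpos ∧ IsInvariantKernel α Kneg ∧
        DisjointKernels Kpos Kneg ∧ K = Kpos - Kneg] := by
  tfae_have 1 → 3 := fun ⟨_, hL, hLinv, h1, h2⟩ =>
    exists_disjoint_decomposition hα hK hKinv hL hLinv h1 h2
  tfae_have 3 → 2 := by
    rintro ⟨Kpos, Kneg, hp, hn, hpi, hni, hd, rfl⟩
    obtain ⟨𝒦, _, _, _, _, V, U, hV, hU, hs, hH⟩ :=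
      exists_kolmogorov_of_disjoint_decomposition hα hp hn hpi hni hd
    exact ⟨𝒦, _, _, _, _, V, U, hV, hU, hs, 𝒦, _, _, ‹_›, U, hH,
      ContinuousLinearEquiv.refl ℂ 𝒦, fun _ => rfl⟩
  tfae_have 2 → 1 := by
    rintro ⟨𝒦, _, _, _, _, V, U, hV, hU, -, 𝒢, _, _, _, T, hT, hUT⟩
    exact exists_dominating_of_similar hα hV hU hT hUT
  tfae_finish
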